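/- Let $\mathcal H$ be a real Hilbert space, and let $A:\mathcal H\to\mathcal H$ be a bounded self-adjoint linear operator that is positive definite in the sense that, for some $c>0$, $\langle Ay,y\rangle\ge c\|y\|^2$ for all $y\in\mathcal H$. For convex $\phi:\mathcal H\to\mathbb R$, let $\partial\phi(u)=\{\xi\in\mathcal H:\ \phi(w)\ge\phi(u)+\langle\xi,w-u\rangle\ \text{for all } w\in\mathcal H\}$. Let $\phi:\mathcal H\to[0,+\infty)$ be a damping potential, that is: $\phi$ is convex and continuous, $\phi(0)=0$, and for every $R>0$ one has $\sup_{\|u\|\le R}\|(\partial\phi)^0(u)\|<+\infty$, where $(\partial\phi)^0(u)$ is the element of minimal norm of $\partial\phi(u)$. Let $x:[0,+\infty)\to\mathcal H$ be a strong global solution of $$\ddot x(t)+\partial\phi(\dot x(t))+Ax(t)\ni 0,$$ that is: $x\in C^1([0,+\infty);\mathcal H)$; for every $T>0$, $\dot x$ is Lipschitz continuous on $[0,T]$ and $\ddot x\in L^\infty(0,T;\mathcal H)$; and the inclusion holds for almost every $t>0$. Then there is $x_\infty\in\mathcal H$ such that $$\frac1t\int_0^t x(\tau)\,d\tau\rightharpoonup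 x_\infty\quad\text{weakly in }\mathcal H\text{ as }t\to+\infty,\qquad 0\in\partial\phi(0)+Ax_\infty .$$ Moreover, if $\phi$ is (Fréchet) differentiable at $0$, then $Ax_\infty=0$, that is, $x_\infty=0$; and if $\phi(u)=r\|u\|$ for all $u\in\mathcal H$, with some $r\ge0$, then $\|Ax_\infty\|\le r$. -/

import Mathlib

open Set Filter Topology MeasureTheory
open scoped InnerProductSpace

/-- The convex subdifferential `∂φ(u)` of a real-valued function on a real Hilbert space. -/
def subdifferential {H : Type*} [NormedAddCommGroup H] [InnerProductSpace ℝ H]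
    (φ : H → ℝ) (u : H) : Set H :=
  {ξ | ∀ w : H, φ u + ⟪ξ, w - u⟫_ℝ ≤ φ w}

/-- `IsMinimalSection φ u ξ` says that `ξ = (∂φ)⁰(u)`, the element of minimal norm of `∂φ(u)`. -/
def IsMinimalSection {H : Type*} [NormedAddCommGroup H] [InnerProductSpace ℝ H]
    (φ : H → ℝ) (u ξ : H) : Prop :=
  ξ ∈ subdifferential φ u ∧ ∀ η ∈ subdifferential φ u, ‖ξ‖ ≤ ‖η‖

/-- Damping potentials: nonnegative convex continuous functions vanishing at the origin, for which
the minimal section of the subdifferential is bounded on bounded sets. -/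
structure IsDampingPotential {H : Type*} [NormedAddCommGroup H] [InnerProductSpace ℝ H]
    (φ : H → ℝ) : Prop where
  nonneg : ∀ u, 0 ≤ φ u
  convex : ConvexOn ℝ univ φ
  continuous : Continuous φ
  map_zero : φ 0 = 0
  minimalSection_bounded : ∀ R : ℝ, 0 < R →
    ∃ M : ℝ, ∀ u ξ : H, ‖u‖ ≤ R → IsMinimalSection φ u ξ → ‖ξ‖ ≤ M

/-- The velocity of a trajectory defined on `[0, +∞)` (one-sided derivative at `0`). -/
noncomputable def velocity {H : Type*} [NormedAddCommGroup H] [InnerProductSpace ℝ H]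
    (x : ℝ → H) : ℝ → H :=
  derivWithin x (Ici 0)

/-- Strong global solutions `x : [0, +∞) → H` of `0 ∈ x''(t) + ∂φ(x'(t)) + B (x(t))`.
Only the values of `x` on `[0, +∞)` matter. The acceleration is the derivative of the velocity,
which exists at almost every time because the velocity is Lipschitz on bounded intervals. -/
structure IsStrongGlobalSolution {H : Type*} [NormedAddCommGroup H] [InnerProductSpace ℝ H]
    (φ : H → ℝ) (B : H → H) (x : ℝ → H) : Prop where
  contDiffOn : ContDiffOn ℝ 1 x (Ici 0)
  velocity_lipschitz : ∀ T : ℝ, 0 < T → ∃ K : NNReal, LipschitzOnWith K (velocity x) (Icc 0 T)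
  acceleration_memLp : ∀ T : ℝ, 0 < T → MemLp (deriv (velocity x)) ⊤ (volume.restrict (Ioo 0 T))
  inclusion : ∀ᵐ t ∂(volume.restrict (Ioi (0 : ℝ))),
    DifferentiableAt ℝ (velocity x) t ∧
      ∃ ξ ∈ subdifferential φ (velocity x t), deriv (velocity x) t + ξ + B (x t) = 0

/-! Opial's argument for averages σ(t). Write v for the velocity and pair the inclusion with v − b,
for a constant b: the subgradient inequality bounds d/dt ½‖v − b‖² by φ(b) − φ(v) − ⟪Ax, v − b⟫
(`norm_velocity_sub_sq_sub_le`).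

For b = 0 and −Ap ∈ ∂φ(0), the energy ‖v‖² + ⟪A(x − p), x − p⟫ decreases. The choice p = 0 bounds x.
Two such energies differ by an affine function of x, so ⟪x, A(p − q)⟫ converges, and so does its
Cesàro mean ⟪σ, A(p − q)⟫.

For general b, averaging gives φ(b) + ⟪σ(t), Ab⟫ ≥ −C/t, so every weak cluster point p of σ has −Ap
∈ ∂φ(0). Two cluster points p, q then satisfy ⟪A(p − q), p − q⟫ = 0, and positivity of A forces p =
q. -/

/-- If half the squared distance from a Lipschitz curve to `b` has derivative at most `h` almost
everywhere, then the corresponding integrated inequality holds. -/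
lemma LipschitzOnWith.norm_sub_sq_sub_le_integral
    {H : Type*} [NormedAddCommGroup H] [InnerProductSpace ℝ H]
    {v : ℝ → H} {K : NNReal} {s t : ℝ} (hst : s ≤ t) (hv : LipschitzOnWith K v (Icc s t)) (b : H)
    {h : ℝ → ℝ} (hh : ContinuousOn h (Icc s t))
    (hd : ∀ᵐ τ ∂(volume.restrict (Icc s t)),
      DifferentiableAt ℝ v τ ∧ ⟪deriv v τ, v τ - b⟫_ℝ ≤ h τ) :
    ‖v t - b‖ ^ 2 - ‖v s - b‖ ^ 2 ≤ 2 * ∫ τ in s..t, h τ := by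
  have hn : AbsolutelyContinuousOnInterval (fun τ => ‖v τ - b‖) s t := by
    have : LipschitzOnWith K (fun τ => ‖v τ - b‖) (uIcc s t) := by
      rw [uIcc_of_le hst]
      refine LipschitzOnWith.of_dist_le_mul fun a ha c hc => ?_
      refine le_trans ?_ (hv.dist_le_mul a ha c hc)
      rw [Real.dist_eq, dist_eq_norm]
      simpa using abs_norm_sub_norm_le (v a - b) (v c - b)
    exact this.absolutelyContinuousOnInterval
  have hn2 : AbsolutelyContinuousOnInterval (fun τ => ‖v τ - b‖ ^ 2) s t := by
    simpa only [sq] using hn.fun_mul hn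
  -- Absolute continuity makes the a.e. derivative enough for the fundamental theorem.
  rw [← hn2.integral_deriv_eq_sub, ← intervalIntegral.integral_const_mul]
  refine intervalIntegral.integral_mono_ae_restrict hst hn2.intervalIntegrable_deriv
    ((hh.const_mul 2).intervalIntegrable_of_Icc hst) ?_
  filter_upwards [hd] with τ ⟨h1, h2⟩
  have := (h1.hasDerivAt.sub_const b).norm_sq.deriv
  rw [this, real_inner_comm]
  linarith

/-- Continuous Cesàro means preserve limits. -/
lemma Filter.Tendsto.integral_cesaro {f : ℝ → ℝ} {l : ℝ} (hf : ContinuousOn f (Ici 0))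
    (h : Tendsto f atTop (𝓝 l)) :
    Tendsto (fun t : ℝ => t⁻¹ * ∫ τ in (0 : ℝ)..t, f τ) atTop (𝓝 l) := by
  have hint : ∀ a b : ℝ, 0 ≤ a → 0 ≤ b → IntervalIntegrable f volume a b := fun a b ha hb =>
    (hf.mono fun y hy => (le_min ha hb).trans hy.1).intervalIntegrable
  rw [Metric.tendsto_atTop] at h ⊢
  intro ε hε
  obtain ⟨N, hN⟩ := h (ε / 2) (by positivity)
  set T := max N 1
  have hT : 0 < T := lt_of_lt_of_le one_pos (le_max_right _ _)
  set K := |(∫ τ in (0 : ℝ)..T, f τ) - T * l|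
  -- Past 2K/ε the error K from [0, T] is below εt/2; the + 1 makes this strict.
  refine ⟨max T (2 * K / ε + 1), fun t ht => ?_⟩
  have htT : T ≤ t := (le_max_left _ _).trans ht
  have ht0 : 0 < t := hT.trans_le htT
  have htK : 2 * K / ε < t := by linarith [(le_max_right T (2 * K / ε + 1)).trans ht]
  have h1 : |(∫ τ in T..t, f τ) - (t - T) * l| ≤ ε / 2 * (t - T) := by
    have : (∫ τ in T..t, f τ) - (t - T) * l = ∫ τ in T..t, (f τ - l) := by
      rw [intervalIntegral.integral_sub (hint _ _ hT.le ht0.le) (by simp)]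
      simp
    rw [this]
    have := intervalIntegral.norm_integral_le_of_norm_le_const (a := T) (b := t)
      (f := fun τ => f τ - l) (C := ε / 2) fun τ hτ => by
        rw [uIoc_of_le htT] at hτ
        exact (hN τ ((le_max_left _ _).trans hτ.1.le)).le
    rwa [abs_of_nonneg (sub_nonneg.2 htT)] at this
  have h2 : t⁻¹ * (∫ τ in (0 : ℝ)..t, f τ) - l = t⁻¹ *
      (((∫ τ in (0 : ℝ)..T, f τ) - T * l) + ((∫ τ in T..t, f τ) - (t - T) * l)) := by
    rw [← intervalIntegral.integral_add_adjacent_intervals (hint 0 T le_rfl hT.le)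
      (hint T t hT.le ht0.le)]
    field_simp
    ring
  rw [Real.dist_eq, h2, abs_mul, abs_of_pos (inv_pos.2 ht0), inv_mul_lt_iff₀ ht0]
  refine (abs_add_le _ _).trans_lt ?_
  rw [div_lt_iff₀ hε] at htK
  have : 0 < ε * T := by positivity
  change K + _ < _
  linarith

/-! ### Weak compactness and weak convergence -/

/-- A bounded curve in a Hilbert space converges weakly along every ultrafilter. -/
lemma Ultrafilter.exists_tendsto_inner
    {H : Type*} [NormedAddCommGroup H] [InnerProductSpace ℝ H] [CompleteSpace H]
    {α : Type*} (U : Ultrafilter α) {σ : α → H} {C : ℝ} (hσ : ∀ᶠ a in U, ‖σ a‖ ≤ C) :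
    ∃ p : H, ∀ y : H, Tendsto (fun a => ⟪σ a, y⟫_ℝ) U (𝓝 ⟪p, y⟫_ℝ) := by
  -- Riesz carries σ into the dual, where Banach–Alaoglu applies.
  let g : α → WeakDual ℝ H := fun a =>
    StrongDual.toWeakDual (InnerProductSpace.toDual ℝ H (σ a))
  have hU : (U.map g : Filter (WeakDual ℝ H)) ≤
      𝓟 (WeakDual.toStrongDual ⁻¹' Metric.closedBall (0 : StrongDual ℝ H) C) := by
    refine le_principal_iff.2 (mem_map.2 ?_)
    filter_upwards [hσ] with a ha
    simpa [g] using ha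
  obtain ⟨f, -, hf⟩ := (WeakDual.isCompact_closedBall (𝕜 := ℝ) (0 : StrongDual ℝ H) C).ultrafilter_le_nhds
    _ hU
  have hf' : Tendsto g U (𝓝 f) := hf
  refine ⟨(InnerProductSpace.toDual ℝ H).symm (WeakDual.toStrongDual f), fun y => ?_⟩
  rw [InnerProductSpace.toDual_symm_apply]
  exact ((WeakDual.eval_continuous y).tendsto f).comp hf'

/-- Weak convergence in a Hilbert space, tested against inner products. -/
lemma tendsto_toWeakSpace_of_tendsto_inner
    {H : Type*} [NormedAddCommGroup H] [InnerProductSpace ℝ H] [CompleteSpace H]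
    {α : Type*} {l : Filter α} {σ : α → H} {p : H}
    (h : ∀ y : H, Tendsto (fun a => ⟪σ a, y⟫_ℝ) l (𝓝 ⟪p, y⟫_ℝ)) :
    Tendsto (fun a => toWeakSpace ℝ H (σ a)) l (𝓝 (toWeakSpace ℝ H p)) := by
  refine (WeakBilin.tendsto_iff_forall_eval_tendsto (B := (topDualPairing ℝ H).flip)
    (fun a c hac => ?_)).2 fun f => ?_
  · exact (SeparatingDual.eq_iff_forall_dual_eq (R := ℝ)).2 fun g => LinearMap.congr_fun hac g
  · have := h ((InnerProductSpace.toDual ℝ H).symm f)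
    simp only [real_inner_comm ((InnerProductSpace.toDual ℝ H).symm f),
      InnerProductSpace.toDual_symm_apply] at this
    exact this

/-- A bounded curve whose weak cluster points along `l` coincide converges weakly along `l`. -/
lemma exists_tendsto_toWeakSpace_of_unique
    {H : Type*} [NormedAddCommGroup H] [InnerProductSpace ℝ H] [CompleteSpace H]
    {α : Type*} {l : Filter α} [l.NeBot] {σ : α → H} {C : ℝ} (hσ : ∀ᶠ a in l, ‖σ a‖ ≤ C)
    {S : Set H}
    (hS : ∀ (U : Ultrafilter α) (p : H), (U : Filter α) ≤ l →
      (∀ y : H, Tendsto (fun a => ⟪σ a, y⟫_ℝ) U (𝓝 ⟪p, y⟫_ℝ)) → p ∈ S)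
    (huniq : ∀ (U V : Ultrafilter α) (p q : H), (U : Filter α) ≤ l → (V : Filter α) ≤ l →
      p ∈ S → q ∈ S → (∀ y : H, Tendsto (fun a => ⟪σ a, y⟫_ℝ) U (𝓝 ⟪p, y⟫_ℝ)) →
      (∀ y : H, Tendsto (fun a => ⟪σ a, y⟫_ℝ) V (𝓝 ⟪q, y⟫_ℝ)) → p = q) :
    ∃ p ∈ S, Tendsto (fun a => toWeakSpace ℝ H (σ a)) l (𝓝 (toWeakSpace ℝ H p)) := by
  obtain ⟨p, hp⟩ := (Ultrafilter.of l).exists_tendsto_inner (hσ.filter_mono (Ultrafilter.of_le l))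
  have hpS := hS _ p (Ultrafilter.of_le l) hp
  refine ⟨p, hpS, tendsto_toWeakSpace_of_tendsto_inner fun y => ?_⟩
  rw [tendsto_iff_ultrafilter]
  intro U hU
  obtain ⟨q, hq⟩ := U.exists_tendsto_inner (hσ.filter_mono hU)
  rw [huniq _ U p q (Ultrafilter.of_le l) hU hpS (hS U q hU hq) hp hq]
  exact hq y

/-! ### Energy estimates along a trajectory -/

namespace IsStrongGlobalSolution

variable {H : Type*} [NormedAddCommGroup H] [InnerProductSpace ℝ H]
  {A : H →L[ℝ] H} {φ : H → ℝ} {x : ℝ → H}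

lemma continuousOn_velocity (hx : IsStrongGlobalSolution φ A x) :
    ContinuousOn (velocity x) (Ici 0) :=
  hx.contDiffOn.continuousOn_derivWithin (uniqueDiffOn_Ici 0) le_rfl

lemma hasDerivAt (hx : IsStrongGlobalSolution φ A x) {t : ℝ} (ht : 0 < t) :
    HasDerivAt x (velocity x t) t :=
  ((hx.contDiffOn.differentiableOn one_ne_zero t ht.le).hasDerivWithinAt).hasDerivAt (Ici_mem_nhds ht)

/-- Integrated variational inequality tested against a constant velocity `b`. -/
lemma norm_velocity_sub_sq_sub_le (hx : IsStrongGlobalSolution φ A x) (hφ : Continuous φ)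
    (b : H) {s t : ℝ} (hs : 0 ≤ s) (hst : s ≤ t) :
    ‖velocity x t - b‖ ^ 2 - ‖velocity x s - b‖ ^ 2 ≤
      2 * ∫ τ in s..t, (φ b - φ (velocity x τ) - ⟪A (x τ), velocity x τ - b⟫_ℝ) := by
  -- The horizon is t + 1 because t may be 0.
  obtain ⟨K, hK⟩ := hx.velocity_lipschitz (t + 1) (by linarith)
  have hsub : Icc s t ⊆ Ici (0 : ℝ) := fun y hy => hs.trans hy.1
  have hv := hx.continuousOn_velocity.mono hsub
  have hxc := hx.contDiffOn.continuousOn.mono hsub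
  refine (hK.mono fun y hy => ⟨hs.trans hy.1, by linarith [hy.2]⟩).norm_sub_sq_sub_le_integral
    hst b ?_ ?_
  · exact (continuousOn_const.sub (hφ.comp_continuousOn hv)).sub
      ((A.continuous.comp_continuousOn hxc).inner (hv.sub continuousOn_const))
  · have : ∀ᵐ τ ∂(volume.restrict (Ici (0 : ℝ))), DifferentiableAt ℝ (velocity x) τ ∧
        ∃ ξ ∈ subdifferential φ (velocity x τ), deriv (velocity x) τ + ξ + A (x τ) = 0 := by
      rw [← restrict_Ioi_eq_restrict_Ici]
      exact hx.inclusion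
    filter_upwards [ae_restrict_of_ae_restrict_of_subset hsub this] with τ ⟨h1, ξ, hξ, h2⟩
    refine ⟨h1, ?_⟩
    have h3 : deriv (velocity x) τ = -ξ - A (x τ) := by
      rw [← sub_eq_zero, ← h2]; abel
    have h4 := hξ b
    rw [← neg_sub, inner_neg_right] at h4
    rw [h3, inner_sub_left, inner_neg_left]
    linarith

/-- The potential energy centred at `p` is the integral of its time derivative. -/
lemma integral_inner_velocity (hA : A.toLinearMap.IsSymmetric) (hx : IsStrongGlobalSolution φ A x)
    (p : H) {s t : ℝ} (hs : 0 ≤ s) (hst : s ≤ t) :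
    2 * ∫ τ in s..t, ⟪A (x τ - p), velocity x τ⟫_ℝ =
      ⟪A (x t - p), x t - p⟫_ℝ - ⟪A (x s - p), x s - p⟫_ℝ := by
  have hsub : Icc s t ⊆ Ici (0 : ℝ) := fun y hy => hs.trans hy.1
  have hv := hx.continuousOn_velocity.mono hsub
  have hxp := (hx.contDiffOn.continuousOn.mono hsub).sub (continuousOn_const (c := p))
  have hAx := A.continuous.comp_continuousOn hxp
  rw [← intervalIntegral.integral_const_mul]
  refine intervalIntegral.integral_eq_sub_of_hasDerivAt_of_le
    (f := fun τ => ⟪A (x τ - p), x τ - p⟫_ℝ) hst (hAx.inner hxp) (fun τ hτ => ?_)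
    (((hAx.inner hv).const_mul 2).intervalIntegrable_of_Icc hst)
  have hd := (hx.hasDerivAt (hs.trans_lt hτ.1)).sub_const p
  refine ((A.hasFDerivAt.comp_hasDerivAt τ hd).inner ℝ hd).congr_deriv ?_
  have : ⟪A (velocity x τ), x τ - p⟫_ℝ = ⟪velocity x τ, A (x τ - p)⟫_ℝ := hA _ _
  rw [this, real_inner_comm (A (x τ - p)) (velocity x τ), Function.comp_apply]
  ring

/-- The energy centred at a stationary point `p` decreases along the trajectory. -/
lemma energy_antitoneOn (hA : A.toLinearMap.IsSymmetric) (hφ : IsDampingPotential φ)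
    (hx : IsStrongGlobalSolution φ A x) {p : H} (hp : -A p ∈ subdifferential φ 0) :
    AntitoneOn (fun t => ‖velocity x t‖ ^ 2 + ⟪A (x t - p), x t - p⟫_ℝ) (Ici 0) := by
  intro s hs t _ hst
  have hs : 0 ≤ s := hs
  have hsub : Icc s t ⊆ Ici (0 : ℝ) := fun y hy => hs.trans hy.1
  have hv := hx.continuousOn_velocity.mono hsub
  have hxc := hx.contDiffOn.continuousOn.mono hsub
  have h1 := hx.norm_velocity_sub_sq_sub_le hφ.continuous 0 hs hst
  have h2 := hx.integral_inner_velocity hA p hs hst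
  simp only [sub_zero, hφ.map_zero, zero_sub] at h1
  have hi1 : IntervalIntegrable (fun τ => -φ (velocity x τ) - ⟪A (x τ), velocity x τ⟫_ℝ)
      volume s t := ContinuousOn.intervalIntegrable_of_Icc hst
    ((hφ.continuous.comp_continuousOn hv).neg.sub ((A.continuous.comp_continuousOn hxc).inner hv))
  have hi2 : IntervalIntegrable (fun τ => ⟪A (x τ - p), velocity x τ⟫_ℝ)
      volume s t := ContinuousOn.intervalIntegrable_of_Icc hst
    ((A.continuous.comp_continuousOn (hxc.sub continuousOn_const)).inner hv)
  have h3 : (∫ τ in s..t, (-φ (velocity x τ) - ⟪A (x τ), velocity x τ⟫_ℝ)) +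
      ∫ τ in s..t, ⟪A (x τ - p), velocity x τ⟫_ℝ ≤ 0 := by
    rw [← intervalIntegral.integral_add hi1 hi2]
    refine (intervalIntegral.integral_mono_on hst (hi1.add hi2)
      (intervalIntegrable_const (c := (0 : ℝ))) fun τ _ => ?_).trans (by simp)
    -- Stationarity tested at the velocity: φ(v) + ⟪Ap, v⟫ ≥ 0.
    have := hp (velocity x τ)
    rw [hφ.map_zero, inner_neg_left, sub_zero] at this
    rw [map_sub, inner_sub_left]
    linarith
  simp only
  linarith

/-- Since φ ≥ 0 = φ(0), the origin is stationary; its energy is coercive. -/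
lemma exists_norm_le (hA : A.toLinearMap.IsSymmetric)
    (hA_pos : ∃ c : ℝ, 0 < c ∧ ∀ y : H, c * ‖y‖ ^ 2 ≤ ⟪A y, y⟫_ℝ) (hφ : IsDampingPotential φ)
    (hx : IsStrongGlobalSolution φ A x) : ∃ C : ℝ, ∀ t, 0 ≤ t → ‖x t‖ ≤ C := by
  obtain ⟨c, hc, hpos⟩ := hA_pos
  have h0 : -A 0 ∈ subdifferential φ 0 := fun w => by simpa [hφ.map_zero] using hφ.nonneg w
  refine ⟨√((‖velocity x 0‖ ^ 2 + ⟪A (x 0 - 0), x 0 - 0⟫_ℝ) / c), fun t ht => ?_⟩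
  refine Real.le_sqrt_of_sq_le ?_
  rw [le_div_iff₀ hc]
  have h1 := hx.energy_antitoneOn hA hφ h0 self_mem_Ici ht ht
  simp only [sub_zero] at h1 ⊢
  nlinarith [hpos (x t), sq_nonneg ‖velocity x t‖]

/-- For stationary points `p`, `q`, the quantity `⟪A (x t), p - q⟫` converges. -/
lemma exists_tendsto_inner (hA : A.toLinearMap.IsSymmetric)
    (hA_pos : ∃ c : ℝ, 0 < c ∧ ∀ y : H, c * ‖y‖ ^ 2 ≤ ⟪A y, y⟫_ℝ) (hφ : IsDampingPotential φ)
    (hx : IsStrongGlobalSolution φ A x) {p q : H} (hp : -A p ∈ subdifferential φ 0)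
    (hq : -A q ∈ subdifferential φ 0) :
    ∃ l : ℝ, Tendsto (fun t => ⟪x t, A (p - q)⟫_ℝ) atTop (𝓝 l) := by
  obtain ⟨c, hc, hpos⟩ := hA_pos
  have key : ∀ p : H, -A p ∈ subdifferential φ 0 → ∃ l : ℝ, Tendsto
      (fun t => ‖velocity x t‖ ^ 2 + ⟪A (x t - p), x t - p⟫_ℝ) atTop (𝓝 l) := by
    intro p hp
    set E := fun t => ‖velocity x t‖ ^ 2 + ⟪A (x t - p), x t - p⟫_ℝ
    -- Freezing E at its value at 0 for t < 0 makes it monotone on all of ℝ.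
    have hanti : Antitone fun t => E (max t 0) := fun s t hst =>
      hx.energy_antitoneOn hA hφ hp (le_max_right s 0) (le_max_right t 0) (max_le_max_right 0 hst)
    have hbdd : BddBelow (range fun t => E (max t 0)) := by
      refine ⟨0, ?_⟩
      rintro _ ⟨t, rfl⟩
      have := hpos (x (max t 0) - p)
      simp only [E]
      have : 0 ≤ c * ‖x (max t 0) - p‖ ^ 2 := by positivity
      linarith [sq_nonneg ‖velocity x (max t 0)‖]
    refine ⟨_, (tendsto_atTop_ciInf hanti hbdd).congr' ?_⟩
    filter_upwards [eventually_ge_atTop 0] with t ht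
    rw [max_eq_left ht]
  obtain ⟨l₁, h₁⟩ := key p hp
  obtain ⟨l₂, h₂⟩ := key q hq
  -- The terms ‖v‖² and ⟪Ax, x⟫ cancel in the difference, which leaves 2⟪x, A(p − q)⟫ plus a
  -- constant.
  refine ⟨_, (((h₂.sub h₁).add_const (⟪A p, p⟫_ℝ - ⟪A q, q⟫_ℝ)).const_mul (1 / 2)).congr fun t => ?_⟩
  have e1 : ∀ p : H, ⟪A p, x t⟫_ℝ = ⟪x t, A p⟫_ℝ := fun p => real_inner_comm _ _
  have e2 : ∀ p : H, ⟪A (x t), p⟫_ℝ = ⟪x t, A p⟫_ℝ := fun p => hA _ _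
  simp only [map_sub, inner_sub_left, inner_sub_right, e1, e2]
  ring

variable [CompleteSpace H]

/-- The averaged variational inequality. -/
lemma neg_le_inner_average (hA : A.toLinearMap.IsSymmetric)
    (hA_pos : ∃ c : ℝ, 0 < c ∧ ∀ y : H, c * ‖y‖ ^ 2 ≤ ⟪A y, y⟫_ℝ) (hφ : IsDampingPotential φ)
    (hx : IsStrongGlobalSolution φ A x) (b : H) :
    ∃ C : ℝ, ∀ t, 0 < t →
      -(t⁻¹ * C) ≤ φ b + ⟪t⁻¹ • ∫ τ in (0 : ℝ)..t, x τ, A b⟫_ℝ := by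
  obtain ⟨c, hc, hpos⟩ := hA_pos
  -- Half the initial energy terms; their nonnegative counterparts at time t, and φ(v), are dropped.
  refine ⟨(‖velocity x 0 - b‖ ^ 2 + ⟪A (x 0), x 0⟫_ℝ) / 2, fun t ht => ?_⟩
  have hsub : Icc 0 t ⊆ Ici (0 : ℝ) := fun y hy => hy.1
  have hv := hx.continuousOn_velocity.mono hsub
  have hxc := hx.contDiffOn.continuousOn.mono hsub
  have h1 := hx.norm_velocity_sub_sq_sub_le hφ.continuous b le_rfl ht.le
  have h2 := hx.integral_inner_velocity hA 0 le_rfl ht.le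
  simp only [sub_zero] at h2
  have hAv : IntervalIntegrable (fun τ => ⟪A (x τ), velocity x τ⟫_ℝ) volume 0 t :=
    ContinuousOn.intervalIntegrable_of_Icc ht.le ((A.continuous.comp_continuousOn hxc).inner hv)
  have hxb : IntervalIntegrable (fun τ => ⟪x τ, A b⟫_ℝ) volume 0 t :=
    ContinuousOn.intervalIntegrable_of_Icc ht.le (hxc.inner continuousOn_const)
  have hb : IntervalIntegrable (fun _ : ℝ => φ b) volume 0 t := intervalIntegrable_const
  have h3 : (∫ τ in (0 : ℝ)..t, (φ b - φ (velocity x τ) - ⟪A (x τ), velocity x τ - b⟫_ℝ)) ≤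
      ∫ τ in (0 : ℝ)..t, (φ b + ⟪x τ, A b⟫_ℝ - ⟪A (x τ), velocity x τ⟫_ℝ) := by
    refine intervalIntegral.integral_mono_on ht.le
      (ContinuousOn.intervalIntegrable_of_Icc ht.le ((continuousOn_const.sub
        (hφ.continuous.comp_continuousOn hv)).sub ((A.continuous.comp_continuousOn hxc).inner
          (hv.sub continuousOn_const)))) ((hb.add hxb).sub hAv) fun τ _ => ?_
    have : ⟪A (x τ), b⟫_ℝ = ⟪x τ, A b⟫_ℝ := hA _ _
    rw [inner_sub_right, this]
    linarith [hφ.nonneg (velocity x τ)]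
  rw [intervalIntegral.integral_sub (hb.add hxb) hAv,
    intervalIntegral.integral_add hb hxb, intervalIntegral.integral_const,
    sub_zero, smul_eq_mul] at h3
  have h4 : ∫ τ in (0 : ℝ)..t, ⟪x τ, A b⟫_ℝ = ⟪∫ τ in (0 : ℝ)..t, x τ, A b⟫_ℝ := by
    have := (innerSL ℝ (A b)).intervalIntegral_comp_comm (hxc.intervalIntegrable_of_Icc (μ := volume) ht.le)
    simpa only [innerSL_apply_apply, real_inner_comm] using this
  have h5 : 0 ≤ ⟪A (x t), x t⟫_ℝ := le_trans (by positivity) (hpos (x t))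
  rw [real_inner_smul_left, ← h4, ← mul_neg, inv_mul_le_iff₀ ht, mul_add, mul_inv_cancel_left₀ ht.ne']
  linarith [sq_nonneg ‖velocity x t - b‖]

end IsStrongGlobalSolution

/-- Both φ and φ − ⟪ξ, ·⟫ are minimal at 0, so both derivatives vanish there. -/
lemma eq_zero_of_mem_subdifferential_of_differentiableAt
    {H : Type*} [NormedAddCommGroup H] [InnerProductSpace ℝ H] {φ : H → ℝ}
    (hφ : IsDampingPotential φ) (hd : DifferentiableAt ℝ φ 0) {ξ : H}
    (hξ : ξ ∈ subdifferential φ 0) : ξ = 0 := by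
  have hφ' : fderiv ℝ φ 0 = 0 := IsLocalMin.fderiv_eq_zero
    (Eventually.of_forall fun w => by rw [hφ.map_zero]; exact hφ.nonneg w)
  have hmin : IsLocalMin (fun w => φ w - innerSL ℝ ξ w) 0 := Eventually.of_forall fun w => by
    have := hξ w
    simp only [sub_zero] at this
    simp only [innerSL_apply_apply, inner_zero_right]
    linarith
  have h := hmin.hasFDerivAt_eq_zero (hd.hasFDerivAt.sub (innerSL ℝ ξ).hasFDerivAt)
  rw [hφ', zero_sub, neg_eq_zero] at h
  simpa using DFunLike.congr_fun h ξ

theorem mainTheorem11 {H : Type*} [NormedAddCommGroup H] [InnerProductSpace ℝ H] [CompleteSpace H]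
    (A : H →L[ℝ] H) (hA : IsSelfAdjoint A)
    (hA_pos : ∃ c : ℝ, 0 < c ∧ ∀ y : H, c * ‖y‖ ^ 2 ≤ ⟪A y, y⟫_ℝ)
    (φ : H → ℝ) (hφ : IsDampingPotential φ)
    (x : ℝ → H) (hx : IsStrongGlobalSolution φ A x) :
    ∃ x_inf : H,
      Tendsto (fun t : ℝ => toWeakSpace ℝ H (t⁻¹ • ∫ τ in (0 : ℝ)..t, x τ)) atTop
        (𝓝 (toWeakSpace ℝ H x_inf)) ∧
      (∃ ξ ∈ subdifferential φ 0, ξ + A x_inf = 0) ∧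
      (DifferentiableAt ℝ φ 0 → A x_inf = 0 ∧ x_inf = 0) ∧
      (∀ r : ℝ, 0 ≤ r → (∀ u : H, φ u = r * ‖u‖) → ‖A x_inf‖ ≤ r) := by
  have hAs : A.toLinearMap.IsSymmetric := hA.isSymmetric
  have hzero : ∀ y : H, ⟪A y, y⟫_ℝ ≤ 0 → y = 0 := fun y hy => by
    obtain ⟨c, hc, hpos⟩ := hA_pos
    have h : ‖y‖ ^ 2 ≤ 0 := by nlinarith [hpos y]
    simpa using pow_eq_zero_iff two_ne_zero |>.1 (le_antisymm h (sq_nonneg _))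
  obtain ⟨C, hC⟩ := hx.exists_norm_le hAs hA_pos hφ
  set σ : ℝ → H := fun t => t⁻¹ • ∫ τ in (0 : ℝ)..t, x τ with hσ
  have hσC : ∀ᶠ t in atTop, ‖σ t‖ ≤ C := by
    filter_upwards [eventually_gt_atTop 0] with t ht
    rw [hσ, norm_smul, Real.norm_eq_abs, abs_of_pos (inv_pos.2 ht), inv_mul_le_iff₀ ht]
    have := intervalIntegral.norm_integral_le_of_norm_le_const (a := 0) (b := t) (f := x) (C := C)
      fun τ hτ => hC τ (by rw [uIoc_of_le ht.le] at hτ; exact hτ.1.le)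
    rwa [sub_zero, abs_of_pos ht, mul_comm] at this
  have hcluster : ∀ (U : Ultrafilter ℝ) (p : H), (U : Filter ℝ) ≤ atTop →
      (∀ y : H, Tendsto (fun t => ⟪σ t, y⟫_ℝ) U (𝓝 ⟪p, y⟫_ℝ)) → -A p ∈ subdifferential φ 0 := by
    intro U p hU hp w
    obtain ⟨K, hK⟩ := hx.neg_le_inner_average hAs hA_pos hφ w
    have h1 : Tendsto (fun t : ℝ => -(t⁻¹ * K)) U (𝓝 0) := by
      simpa using ((tendsto_inv_atTop_zero.mul_const K).neg).mono_left hU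
    have h2 := le_of_tendsto_of_tendsto h1 ((hp (A w)).const_add (φ w))
      (((eventually_gt_atTop 0).mono hK).filter_mono hU)
    have h3 : ⟪A p, w⟫_ℝ = ⟪p, A w⟫_ℝ := hAs _ _
    rw [hφ.map_zero, sub_zero, inner_neg_left, h3]
    linarith
  obtain ⟨p, hp, hlim⟩ := exists_tendsto_toWeakSpace_of_unique hσC
    (S := {p | -A p ∈ subdifferential φ 0}) hcluster (by
    intro U V p q hU hV hp hq hUp hVq
    obtain ⟨l, hl⟩ := hx.exists_tendsto_inner hAs hA_pos hφ hp hq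
    have hces : Tendsto (fun t => ⟪σ t, A (p - q)⟫_ℝ) atTop (𝓝 l) := by
      refine (hl.integral_cesaro
        (hx.contDiffOn.continuousOn.inner continuousOn_const)).congr' ?_
      filter_upwards [eventually_ge_atTop 0] with t ht
      have := (innerSL ℝ (A (p - q))).intervalIntegral_comp_comm
        ((hx.contDiffOn.continuousOn.mono fun y hy => hy.1).intervalIntegrable_of_Icc (μ := volume) ht)
      simp only [innerSL_apply_apply] at this
      rw [hσ, real_inner_smul_left, real_inner_comm, ← this]
      simp only [real_inner_comm]
    have h1 := tendsto_nhds_unique (hUp (A (p - q))) (hces.mono_left hU)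
    have h2 := tendsto_nhds_unique (hVq (A (p - q))) (hces.mono_left hV)
    refine sub_eq_zero.1 (hzero _ (le_of_eq ?_))
    rw [real_inner_comm, inner_sub_left, h1, h2, sub_self])
  refine ⟨p, hlim, ⟨-A p, hp, neg_add_cancel _⟩, fun hd => ?_, fun r hr hφr => ?_⟩
  · have h := neg_eq_zero.1 (eq_zero_of_mem_subdifferential_of_differentiableAt hφ hd hp)
    exact ⟨h, hzero p (by simp [h])⟩
  -- Testing with w = −Ap gives ‖Ap‖² ≤ r‖Ap‖.
  · have h := hp (-A p)
    rw [hφ.map_zero, sub_zero, real_inner_self_eq_norm_sq, hφr, norm_neg] at h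
    by_contra! hlt
    nlinarith
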